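/- **Setting.** A *model set-up* consists of a dimension $d$, a measurable context space $\mathcal X\subseteq\mathbb R^d$, a probability distribution $P_{\mathcal X}$ with support $\mathcal X$, a price interval $[\underline p,\overline p]\subseteq[0,1]$ with $\underline p<\overline p$, and parameter classes $\Theta\subseteq\mathbb R^d$, $A\subseteq[0,\infty)$. Demand is linear, $f(u)=u$: a customer with context $x$ who is offered price $p$ has demand $y\in\{0,1\}$ with $\mathbb E[y\mid x,p]=f(x^\top\theta-\alpha p)=x^\top\theta-\alpha p$. Let $r_u(p)=p\,f(u-\alpha p)$. The set-up satisfies the *assumptions* if there are constants $0<B\le\tilde B$, $-B\le b_1\le b_2\le B$, $L_f$, $L_U$ and $\sigma_r,\sigma_x>0$ such that for all $\theta\in\Theta$, $\alpha\in A$: 1. for all $x\in\mathcal X$, $p\in[\underline p,\overline p]$: $x^\top\theta\in[b_1,b_2]$, $x^\top\theta-\alpha p\in[-\tilde B,\tilde B]$ and $f(x^\top\theta-\alpha p)\in[0,1]$; 2. $f$ is $C^2$ with $|f|,|f'|,|f''|\le L_f$ on $[-\tilde B,\tilde B]$, and for every $u\in[b_1,b_2]$ there is $p^*(u)\in(\underline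 p,\overline p)$ such that $r_u$ is non-decreasing on $[\underline p,p^*(u)]$, non-increasing on $[p^*(u),\overline p]$, and $r_u(p')\le r_u(p^*(u))-\frac{\sigma_r}{2}(p'-p^*(u))^2$ for all $p'\in[\underline p,\overline p]$; 3. $\Pr_{x\sim P_{\mathcal X}}[x^\top\theta\in U]\le L_U|U|/(2B)$ for every measurable $U\subseteq[-B,B]$, where $|U|$ is Lebesgue measure; 4. $P_{\mathcal X}$ has finite second moments and $\lambda_{\min}(\mathrm{Cov}(P_{\mathcal X}))\ge\sigma_x$. A policy $\pi:\mathcal X\to[\underline p,\overline p]$ is *$\delta_0$-utility fair* ($\delta_0$-UF) under $(\theta,\alpha)$ if $|\pi(x)-\pi(x')|\le\delta_0|(x-x')^\top\theta|$ for all $x,x'\in\mathcal X$; $\mathcal F_{\theta,\alpha}(\delta_0)$ is the set of these policies, and $R_{\theta,\alpha}(\pi)=\mathbb E_{x\sim P_{\mathcal X}}[\pi(x)(x^\top\theta-\alpha\pi(x))]$. A (possibly randomized) learning algorithm over $T$ periods chooses in each period $t$ a policy $\pi_t$ that depends measurably on its internal randomness and on the contexts, prices and demands of the earlier periods; then $x_t\sim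 P_{\mathcal X}$ arrives independently, the price $\pi_t(x_t)$ is offered, and a Bernoulli demand $y_t$ with mean $x_t^\top\theta-\alpha\pi_t(x_t)$ is observed. **Theorem ($T^{2/3}$ regret lower bound).** There is a universal constant $c>0$ such that for every $\delta_0\in(0,1/2]$ there are $\underline C>0$ and $T_0\in\mathbb N$ (depending only on $\delta_0$) and a model set-up, not depending on $T$, that satisfies the assumptions and for which the maximum of $R_{\theta,\alpha}$ over $\mathcal F_{\theta,\alpha}(\delta_0)$ is attained for all $(\theta,\alpha)\in\Theta\times A$, such that the following holds. For every $T$ and every learning algorithm over $T$ periods with $$\Pr_{\theta,\alpha}\big[\pi_1,\dots,\pi_T\in\mathcal F_{\theta,\alpha}(\delta_0)\big]\ge 0.95\qquad\text{for all }(\theta,\alpha)\in\Theta\times A,$$ one has $$\sup_{(\theta,\alpha)\in\Theta\times A}\mathbb E_{\theta,\alpha}\Big[\sum_{t=1}^T\Big(\max_{\pi\in\mathcal F_{\theta,\alpha}(\delta_0)}R_{\theta,\alpha}(\pi)-R_{\theta,\alpha}(\pi_t)\Big)\Big]\ \ge\ \underline C\,T^{2/3},$$ and if $T\ge T_0$,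 the same supremum is at least $c\,\delta_0^{2/3}\,T^{2/3}$. -/

import Mathlib

open MeasureTheory Set

noncomputable section

/-- A model set-up for contextual pricing: a context space `𝒳 ⊆ ℝᵈ`, the distribution `P` of the
contexts on `𝒳`, a price interval `[pLow, pHigh] ⊆ [0, 1]`, and the parameter classes
`Θ ⊆ ℝᵈ` and `A ⊆ ℝ₊` that contain the unknown `θ` and `α`. -/
structure PricingModel (d : ℕ) where
  𝒳 : Set (EuclideanSpace ℝ (Fin d))
  measurableSet_𝒳 : MeasurableSet 𝒳
  P : Measure 𝒳
  isProb : IsProbabilityMeasure P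
  /-- the support of `P` is all of `𝒳` -/
  fullSupport : P.IsOpenPosMeasure
  pLow : ℝ
  pHigh : ℝ
  pLow_nonneg : 0 ≤ pLow
  pLow_lt_pHigh : pLow < pHigh
  pHigh_le_one : pHigh ≤ 1
  Θ : Set (EuclideanSpace ℝ (Fin d))
  A : Set ℝ
  A_nonneg : ∀ α ∈ A, 0 ≤ α

attribute [instance] PricingModel.isProb

namespace PricingModel

variable {d : ℕ}

/-- Baseline utility `xᵀθ` of a customer with context `x`. -/
def utility (x θ : EuclideanSpace ℝ (Fin d)) : ℝ := inner ℝ x θ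

/-- Expected demand `f(xᵀθ - αp)` for link function `f`. -/
def demand (f : ℝ → ℝ) (θ : EuclideanSpace ℝ (Fin d)) (α : ℝ)
    (x : EuclideanSpace ℝ (Fin d)) (p : ℝ) : ℝ := f (utility x θ - α * p)

/-- Expected revenue `r_u(p) = p f(u - αp)` at baseline utility `u` and price `p`. -/
def revenueAt (f : ℝ → ℝ) (α u p : ℝ) : ℝ := p * f (u - α * p)

/-- The covariance matrix `E[xxᵀ] - E[x]E[x]ᵀ` of the contexts. -/
def covMatrix (M : PricingModel d) : Matrix (Fin d) (Fin d) ℝ :=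
  Matrix.of fun i j =>
    (∫ x, x.1 i * x.1 j ∂M.P) - (∫ x, x.1 i ∂M.P) * (∫ x, x.1 j ∂M.P)

/-- Boundedness: utilities lie in the compact interval `[b₁, b₂] ⊆ [-B, B]`, net utilities lie in
`[-B', B']` and expected demands lie in `[0, 1]`. -/
def Boundedness (M : PricingModel d) (f : ℝ → ℝ) (B B' b₁ b₂ : ℝ) : Prop :=
  0 < B ∧ B ≤ B' ∧ -B ≤ b₁ ∧ b₁ ≤ b₂ ∧ b₂ ≤ B ∧
  ∀ x ∈ M.𝒳, ∀ p ∈ Icc M.pLow M.pHigh, ∀ θ ∈ M.Θ, ∀ α ∈ M.A,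
    utility x θ ∈ Icc b₁ b₂ ∧ utility x θ - α * p ∈ Icc (-B') B' ∧
    demand f θ α x p ∈ Icc (0 : ℝ) 1

/-- Smooth link and strongly unimodal revenue: `f` is `C²` with `|f|, |f'|, |f''| ≤ L` on
`[-B', B']`, and for all utilities in `[b₁, b₂]` the revenue is unimodal, with a strictly interior
maximizer from which it decays at least quadratically (so that the maximizer is unique). -/
def SmoothUnimodal (M : PricingModel d) (f : ℝ → ℝ) (B' b₁ b₂ L σ : ℝ) : Prop :=
  0 < σ ∧ ContDiff ℝ 2 f ∧
  (∀ u ∈ Icc (-B') B', |f u| ≤ L ∧ |deriv f u| ≤ L ∧ |deriv (deriv f) u| ≤ L) ∧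
  ∀ α ∈ M.A, ∀ u ∈ Icc b₁ b₂, ∃ p ∈ Ioo M.pLow M.pHigh,
    MonotoneOn (revenueAt f α u) (Icc M.pLow p) ∧
    AntitoneOn (revenueAt f α u) (Icc p M.pHigh) ∧
    ∀ p' ∈ Icc M.pLow M.pHigh,
      revenueAt f α u p' ≤ revenueAt f α u p - σ / 2 * (p' - p) ^ 2

/-- Stochastic contexts: `P[xᵀθ ∈ U] ≤ L |U| / (2B)` for measurable `U ⊆ [-B, B]`. -/
def StochasticContexts (M : PricingModel d) (B L : ℝ) : Prop :=
  ∀ θ ∈ M.Θ, ∀ U : Set ℝ, MeasurableSet U → U ⊆ Icc (-B) B →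
    M.P.real {x | utility x.1 θ ∈ U} ≤ L * volume.real U / (2 * B)

/-- Non-degenerate covariance: `λ_min(Cov(P)) ≥ σ > 0`, that is, `Cov(P) - σ I ⪰ 0`. -/
def CovNondegenerate (M : PricingModel d) (σ : ℝ) : Prop :=
  0 < σ ∧ MemLp (fun x : M.𝒳 => x.1) 2 M.P ∧
    (M.covMatrix - σ • (1 : Matrix (Fin d) (Fin d) ℝ)).PosSemidef

/-- All standing assumptions, with constants that are uniform over `Θ × A`. -/
def Assumptions (M : PricingModel d) (f : ℝ → ℝ) : Prop :=
  ∃ B B' b₁ b₂ Lf σr LU σx : ℝ,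
    M.Boundedness f B B' b₁ b₂ ∧ M.SmoothUnimodal f B' b₁ b₂ Lf σr ∧
    M.StochasticContexts B LU ∧ M.CovNondegenerate σx

/-- A (deterministic) contextual pricing policy `π : 𝒳 → [pLow, pHigh]`. -/
abbrev Policy (M : PricingModel d) : Type := M.𝒳 → Icc M.pLow M.pHigh

/-- The class of `δ`-utility-fair policies under the parameter `θ`
(fairness does not involve `α`). -/
def fairPolicies (M : PricingModel d) (θ : EuclideanSpace ℝ (Fin d)) (δ : ℝ) : Set M.Policy :=
  {π | ∀ x x' : M.𝒳, |(π x : ℝ) - (π x' : ℝ)| ≤ δ * |utility (x.1 - x'.1) θ|}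

/-- Expected revenue `R_{θ,α}(π) = E_{x ∼ P}[π(x) f(xᵀθ - απ(x))]` of a policy. -/
def revenue (M : PricingModel d) (f : ℝ → ℝ) (θ : EuclideanSpace ℝ (Fin d)) (α : ℝ)
    (π : M.Policy) : ℝ :=
  ∫ x, revenueAt f α (utility x.1 θ) (π x) ∂M.P

/-- `max_{π ∈ F_θ(δ)} R_{θ,α}(π)`, as a supremum of a nonempty bounded set of reals. -/
def optRevenue (M : PricingModel d) (f : ℝ → ℝ) (δ : ℝ) (θ : EuclideanSpace ℝ (Fin d))
    (α : ℝ) : ℝ :=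
  sSup (M.revenue f θ α '' M.fairPolicies θ δ)

/-- The optimal fair revenue is attained. -/
def HasOptimalFairPolicy (M : PricingModel d) (f : ℝ → ℝ) (δ : ℝ)
    (θ : EuclideanSpace ℝ (Fin d)) (α : ℝ) : Prop :=
  ∃ π ∈ M.fairPolicies θ δ, ∀ π' ∈ M.fairPolicies θ δ, M.revenue f θ α π' ≤ M.revenue f θ α π

/-- A learning algorithm with internal randomness `ω ∈ Ω`. The policy used in period `t`
(periods are numbered from `0`) is a function of `ω` and of the contexts and realized demands
of the periods before `t`; `true` stands for the demand `y = 1` and `false` for `y = 0`.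
The past prices are functions of the same data. Over `T` periods only `policy 0, …,
policy (T - 1)` are used. -/
structure Algorithm (M : PricingModel d) (Ω : Type*) [MeasurableSpace Ω] where
  policy : (t : ℕ) → Ω → (Fin t → M.𝒳 × Bool) → M.Policy
  measurable_policy : ∀ t : ℕ,
    Measurable fun z : Ω × (Fin t → M.𝒳 × Bool) × M.𝒳 => policy t z.1 z.2.1 z.2.2

/-- The sample space of an interaction: the algorithm's internal randomness and, for each period,
a context and a number in `[0, 1]`, which generates that period's demand. -/
abbrev Sample (M : PricingModel d) (Ω : Type*) : Type _ := Ω × (ℕ → M.𝒳 × unitInterval)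

/-- The probability on the sample space: internal randomness `ω ∼ ν`, contexts `xₜ ∼ P` and
`vₜ` uniform on `[0, 1]`, all independent. -/
def sampleLaw (M : PricingModel d) {Ω : Type*} [MeasurableSpace Ω] (ν : Measure Ω) :
    Measure (M.Sample Ω) :=
  ν.prod (Measure.infinitePi fun _ : ℕ => M.P.prod (volume : Measure unitInterval))

namespace Algorithm

variable {M : PricingModel d} {Ω : Type*} [MeasurableSpace Ω]

/-- The contexts and demands of the first `t` periods under the instance `(θ, α)`. In period `t`
the price is `πₜ(xₜ)`, and the demand is `yₜ = 1` exactly if `vₜ ≤ f(xₜᵀθ - απₜ(xₜ))`: as `vₜ` is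
uniform and independent of `xₜ` and of the past, `yₜ` is, given these, a Bernoulli variable of
mean `f(xₜᵀθ - απₜ(xₜ))` (see `demand_bernoulli`). -/
def history (𝒜 : M.Algorithm Ω) (f : ℝ → ℝ) (θ : EuclideanSpace ℝ (Fin d)) (α : ℝ)
    (z : M.Sample Ω) : (t : ℕ) → (Fin t → M.𝒳 × Bool)
  | 0 => Fin.elim0
  | t + 1 =>
    Fin.snoc (α := fun _ => M.𝒳 × Bool) (history 𝒜 f θ α z t)
      ((z.2 t).1,
        decide (((z.2 t).2 : ℝ) ≤
          demand f θ α (z.2 t).1 (𝒜.policy t z.1 (history 𝒜 f θ α z t) (z.2 t).1)))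

/-- The policy `πₜ` implemented in period `t` under the instance `(θ, α)`. -/
def played (𝒜 : M.Algorithm Ω) (f : ℝ → ℝ) (θ : EuclideanSpace ℝ (Fin d)) (α : ℝ) (t : ℕ)
    (z : M.Sample Ω) : M.Policy :=
  𝒜.policy t z.1 (𝒜.history f θ α z t)

/-- Under the instance `(θ, α)`, all policies of the first `T` periods are `δ`-utility fair with
probability at least `q`. (The event is not presupposed measurable: it is required to contain a
measurable event of probability at least `q`.) -/
def FairWithProb (𝒜 : M.Algorithm Ω) (f : ℝ → ℝ) (ν : Measure Ω) (T : ℕ) (δ q : ℝ)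
    (θ : EuclideanSpace ℝ (Fin d)) (α : ℝ) : Prop :=
  ∃ E : Set (M.Sample Ω), MeasurableSet E ∧
    E ⊆ {z | ∀ t < T, 𝒜.played f θ α t z ∈ M.fairPolicies θ δ} ∧
    q ≤ (M.sampleLaw ν).real E

/-- Expected cumulative regret over `T` periods under the instance `(θ, α)`, with respect to the
best `δ`-utility-fair policy. -/
def expectedRegret (𝒜 : M.Algorithm Ω) (f : ℝ → ℝ) (ν : Measure Ω) (T : ℕ) (δ : ℝ)
    (θ : EuclideanSpace ℝ (Fin d)) (α : ℝ) : ℝ :=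
  ∫ z, ∑ t ∈ Finset.range T,
    (M.optRevenue f δ θ α - M.revenue f θ α (𝒜.played f θ α t z)) ∂(M.sampleLaw ν)

/-- `sup_{(θ, α) ∈ Θ × A}` of the expected regret, in the extended reals. -/
def worstCaseRegret (𝒜 : M.Algorithm Ω) (f : ℝ → ℝ) (ν : Measure Ω) (T : ℕ) (δ : ℝ) : EReal :=
  ⨆ θ ∈ M.Θ, ⨆ α ∈ M.A, ((𝒜.expectedRegret f ν T δ θ α : ℝ) : EReal)

end Algorithm

/-- Thresholding a uniform variable at `q ∈ [0, 1]` gives a Bernoulli variable of mean `q`. -/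
theorem demand_bernoulli (q : ℝ) (hq : q ∈ Icc (0 : ℝ) 1) :
    (volume : Measure unitInterval).real {v | (v : ℝ) ≤ q} = q := by
  have : {v : unitInterval | (v : ℝ) ≤ q} = Iic (⟨q, hq⟩ : unitInterval) := by
    ext v; exact Iff.rfl
  rw [this, Measure.real, unitInterval.volume_Iic]
  simp [hq.1]

end PricingModel

end

/-! Exact fairness is so rigid that it forces linear regret, which dominates `T ^ (2/3)`. A policy
that is fair under `θ` is a Lipschitz function of `xᵀθ`, hence constant along the level lines of
that functional. If it is also fair under a second, non-parallel direction, however close, one can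
zigzag between the two families of level lines, so the policy is constant on the whole square of
contexts (`eq_of_lipschitz_two_directions`, `fairPolicies_inter_const`).

Take `θ = (1/2, 1/2)` and `θ' = (1/2, 1/2 - ε)` with `ε` of order `1/T`. Feed both instances the
same contexts and the same uniform variables. In each period the demands differ with probability at
most `ε`, so with probability at least `1 - Tε` the two histories coincide for all `T` periods. An
algorithm that is fair with probability `0.95` under each instance therefore plays, with probability
at least `0.9 - Tε`, only policies fair under both (`exists_fair_under_both`), and these are
constant.

The model is arranged so that the unconstrained optimal price `u / (2α)` is itself fair. A constant
price then loses at least `α` times the variance of the optimal price, a fixed multiple of `δ`, in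
every period (`regret_const_ge`). No policy has negative regret, so the remaining event can be
discarded (`le_expectedRegret`). -/

noncomputable section

namespace PricingModel

/-! ### Resampling and thresholds of uniform variables -/

/-- Resampling one coordinate of an i.i.d. sequence does not change its law. -/
theorem infinitePi_map_update {X : Type*} [MeasurableSpace X] (Q : Measure X)
    [IsProbabilityMeasure Q] (t : ℕ) :
    ((Measure.infinitePi fun _ : ℕ => Q).prod Q).map
      (fun z : (ℕ → X) × X => Function.update z.1 t z.2) = Measure.infinitePi fun _ : ℕ => Q := by
  have hm : Measurable fun z : (ℕ → X) × X => Function.update z.1 t z.2 := by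
    refine measurable_pi_iff.2 fun i => ?_
    by_cases h : i = t
    · subst h; simpa using measurable_snd
    · simpa [h, Function.comp_def] using (measurable_pi_apply i).comp measurable_fst
  refine Measure.eq_infinitePi _ fun s B hB => ?_
  rw [Measure.map_apply hm (MeasurableSet.pi s.countable_toSet fun i _ => hB i)]
  by_cases hts : t ∈ s
  · have : (fun z : (ℕ → X) × X => Function.update z.1 t z.2) ⁻¹' (Set.pi s B) =
        (Set.pi (s.erase t : Finset ℕ) B) ×ˢ (B t) := by
      ext ⟨z, x⟩
      simp only [mem_preimage, Set.mem_pi, Finset.mem_coe, mem_prod, Finset.mem_erase]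
      constructor
      · intro h
        exact ⟨fun i hi => by simpa [hi.1] using h i hi.2, by simpa using h t hts⟩
      · rintro ⟨h1, h2⟩ i hi
        by_cases h : i = t
        · subst h; simpa using h2
        · simpa [h] using h1 i ⟨h, hi⟩
    rw [this, Measure.prod_prod, Measure.infinitePi_pi _ (fun i _ => hB i),
      Finset.prod_erase_mul _ _ hts]
  · have : (fun z : (ℕ → X) × X => Function.update z.1 t z.2) ⁻¹' (Set.pi s B) =
        (Set.pi s B) ×ˢ univ := by
      ext ⟨z, x⟩
      simp only [mem_preimage, Set.mem_pi, Finset.mem_coe, mem_prod, mem_univ, and_true]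
      refine forall₂_congr fun i hi => ?_
      have : i ≠ t := fun h => hts (h ▸ hi)
      simp [this]
    rw [this, Measure.prod_prod, Measure.infinitePi_pi _ (fun i _ => hB i)]
    simp

/-- A uniform variable separates two thresholds with probability at most their distance. -/
theorem volume_separates_le (a b : ℝ) :
    (volume : Measure unitInterval) {v | ¬((v : ℝ) ≤ a ↔ (v : ℝ) ≤ b)} ≤
      ENNReal.ofReal |a - b| := by
  rw [unitInterval.volume_apply]
  have : Subtype.val '' {v : unitInterval | ¬((v : ℝ) ≤ a ↔ (v : ℝ) ≤ b)} ⊆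
      Set.uIoc b a := by
    rintro _ ⟨v, hv, rfl⟩
    rw [Set.mem_uIoc]
    by_contra h
    push Not at h
    apply hv
    constructor
    · intro h1
      by_contra h2
      exact absurd (h.1 (not_le.1 h2)) (not_lt.2 h1)
    · intro h1
      by_contra h2
      exact absurd (h.2 (not_le.1 h2)) (not_lt.2 h1)
  refine (measure_mono this).trans ?_
  rw [Real.volume_uIoc]

variable {d : ℕ} {M : PricingModel d} {Ω : Type*} [MeasurableSpace Ω]

instance isProbabilityMeasure_sampleLaw (ν : Measure Ω) [IsProbabilityMeasure ν] :
    IsProbabilityMeasure (M.sampleLaw ν) := by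
  unfold sampleLaw; infer_instance

theorem measurable_utility (θ : EuclideanSpace ℝ (Fin d)) :
    Measurable fun x : M.𝒳 => utility x.1 θ := by
  unfold utility
  exact measurable_subtype_coe.inner_const

/-! ### Coupling two instances through common randomness -/

namespace Algorithm

variable (𝒜 : M.Algorithm Ω) (f : ℝ → ℝ)
  (θ θ' : EuclideanSpace ℝ (Fin d)) (α α' : ℝ)

theorem measurable_history (hf : Measurable f) (t : ℕ) :
    Measurable fun z : M.Sample Ω => 𝒜.history f θ α z t := by
  induction t with
  | zero => exact measurable_const
  | succ t ih =>
    have hx : Measurable fun z : M.Sample Ω => (z.2 t).1 :=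
      measurable_fst.comp ((measurable_pi_apply t).comp measurable_snd)
    have hv : Measurable fun z : M.Sample Ω => ((z.2 t).2 : ℝ) :=
      measurable_subtype_coe.comp
        (measurable_snd.comp ((measurable_pi_apply t).comp measurable_snd))
    have hp : Measurable fun z : M.Sample Ω =>
        ((𝒜.policy t z.1 (𝒜.history f θ α z t) (z.2 t).1 : Icc M.pLow M.pHigh) : ℝ) :=
      measurable_subtype_coe.comp
        ((𝒜.measurable_policy t).comp (measurable_fst.prodMk (ih.prodMk hx)))
    refine measurable_pi_iff.2 fun i => ?_
    induction i using Fin.lastCases with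
    | last =>
      simp only [history, Fin.snoc_last]
      refine hx.prodMk (measurable_to_bool ?_)
      have : MeasurableSet {z : M.Sample Ω | ((z.2 t).2 : ℝ) ≤
          demand f θ α (z.2 t).1 (𝒜.policy t z.1 (𝒜.history f θ α z t) (z.2 t).1)} := by
        refine measurableSet_le hv (hf.comp ?_)
        exact ((measurable_utility θ).comp hx).sub (hp.const_mul α)
      convert this using 1
      ext z
      simp
    | cast i =>
      simp only [history, Fin.snoc_castSucc]
      exact (measurable_pi_apply i).comp ih

theorem measurable_revenue_played (hf : Measurable f) (t : ℕ) :
    Measurable fun z : M.Sample Ω => M.revenue f θ α (𝒜.played f θ α t z) := by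
  have hp : Measurable fun w : M.Sample Ω × M.𝒳 =>
      ((𝒜.played f θ α t w.1 w.2 : Icc M.pLow M.pHigh) : ℝ) :=
    measurable_subtype_coe.comp ((𝒜.measurable_policy t).comp
      ((measurable_fst.comp measurable_fst).prodMk
        (((𝒜.measurable_history f θ α hf t).comp measurable_fst).prodMk measurable_snd)))
  have : Measurable fun w : M.Sample Ω × M.𝒳 =>
      revenueAt f α (utility w.2.1 θ) (𝒜.played f θ α t w.1 w.2) :=
    hp.mul (hf.comp (((measurable_utility θ).comp measurable_snd).sub (hp.const_mul α)))
  exact this.stronglyMeasurable.integral_prod_right'.measurable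

/-- The history of the first `t` periods depends on the first `t` coordinates only. -/
theorem history_update (ω : Ω) (s : ℕ → M.𝒳 × unitInterval) (n : ℕ) (y : M.𝒳 × unitInterval)
    {t : ℕ} (ht : t ≤ n) :
    𝒜.history f θ α (ω, Function.update s n y) t = 𝒜.history f θ α (ω, s) t := by
  induction t with
  | zero => rfl
  | succ t ih =>
    have : t ≠ n := by omega
    simp only [history, ih (by omega), Function.update_of_ne this]

/-- The demands of period `t` under two parameters are realized differently, at the price that is
played under the first one. -/
def disagreement (t : ℕ) : Set (M.Sample Ω) :=
  {z | ¬(((z.2 t).2 : ℝ) ≤ demand f θ α (z.2 t).1 (𝒜.played f θ α t z (z.2 t).1) ↔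
    ((z.2 t).2 : ℝ) ≤ demand f θ' α' (z.2 t).1 (𝒜.played f θ α t z (z.2 t).1))}

/-- Equal histories give equal policies and hence equal prices, so comparing demands at the price of
the first instance is enough to carry the induction. -/
theorem history_eq_of_notMem_disagreement {z : M.Sample Ω} {T : ℕ}
    (hz : ∀ t < T, z ∉ 𝒜.disagreement f θ θ' α α' t) {t : ℕ} (ht : t ≤ T) :
    𝒜.history f θ α z t = 𝒜.history f θ' α' z t := by
  induction t with
  | zero => rfl
  | succ t ih =>
    have h1 := ih (by omega)
    have h2 := hz t (by omega)
    simp only [disagreement, played, mem_ofPred_eq, not_not] at h2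
    simp only [history]
    rw [h1] at h2 ⊢
    simp only [h2]

theorem measurableSet_disagreement (hf : Measurable f) (t : ℕ) :
    MeasurableSet (𝒜.disagreement f θ θ' α α' t) := by
  have hx : Measurable fun z : M.Sample Ω => (z.2 t).1 :=
    measurable_fst.comp ((measurable_pi_apply t).comp measurable_snd)
  have hv : Measurable fun z : M.Sample Ω => ((z.2 t).2 : ℝ) :=
    measurable_subtype_coe.comp
      (measurable_snd.comp ((measurable_pi_apply t).comp measurable_snd))
  have hp : Measurable fun z : M.Sample Ω =>
      ((𝒜.played f θ α t z (z.2 t).1 : Icc M.pLow M.pHigh) : ℝ) :=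
    measurable_subtype_coe.comp ((𝒜.measurable_policy t).comp
      (measurable_fst.prodMk ((𝒜.measurable_history f θ α hf t).prodMk hx)))
  have key : ∀ (ϑ : EuclideanSpace ℝ (Fin d)) (a : ℝ), MeasurableSet {z : M.Sample Ω |
      ((z.2 t).2 : ℝ) ≤ demand f ϑ a (z.2 t).1 (𝒜.played f θ α t z (z.2 t).1)} := fun ϑ a =>
    measurableSet_le hv (hf.comp (((measurable_utility ϑ).comp hx).sub (hp.const_mul a)))
  have : 𝒜.disagreement f θ θ' α α' t = symmDiff
      {z : M.Sample Ω |
        ((z.2 t).2 : ℝ) ≤ demand f θ α (z.2 t).1 (𝒜.played f θ α t z (z.2 t).1)}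
      {z : M.Sample Ω |
        ((z.2 t).2 : ℝ) ≤ demand f θ' α' (z.2 t).1 (𝒜.played f θ α t z (z.2 t).1)} := by
    ext z
    simp only [disagreement, mem_ofPred_eq, Set.mem_symmDiff]
    tauto
  rw [this]
  exact (key θ α).symmDiff (key θ' α')

/-- Conditionally on the past and on the context of period `t`, both thresholds are fixed numbers at
distance at most `η`, and the uniform variable falls between them with probability at most `η`. -/
theorem sampleLaw_disagreement_le (hf : Measurable f) (ν : Measure Ω) [IsProbabilityMeasure ν]
    {η : ℝ} (hη : ∀ (x : M.𝒳) (p : Icc M.pLow M.pHigh),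
      |demand f θ α x p - demand f θ' α' x p| ≤ η) (t : ℕ) :
    M.sampleLaw ν (𝒜.disagreement f θ θ' α α' t) ≤ ENNReal.ofReal η := by
  have hS := 𝒜.measurableSet_disagreement f θ θ' α α' hf t
  unfold sampleLaw
  rw [Measure.prod_apply hS]
  refine (lintegral_mono fun ω => ?_).trans (by simp : ∫⁻ _, ENNReal.ofReal η ∂ν ≤ _)
  have hm : Measurable fun z : (ℕ → M.𝒳 × unitInterval) × (M.𝒳 × unitInterval) =>
      Function.update z.1 t z.2 := by
    refine measurable_pi_iff.2 fun i => ?_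
    by_cases h : i = t
    · subst h; simpa using measurable_snd
    · simpa [h, Function.comp_def] using (measurable_pi_apply i).comp measurable_fst
  have hSω := hS.preimage (measurable_prodMk_left (x := ω))
  -- Coordinate `t` is replaced by a fresh copy, so that its context and uniform variable can be
  -- integrated with the rest frozen; by `history_update` the past does not see the change.
  rw [← infinitePi_map_update (M.P.prod (volume : Measure unitInterval)) t,
    Measure.map_apply hm hSω, Measure.prod_apply (hm hSω)]
  refine (lintegral_mono fun s => ?_).trans (by simp :
    ∫⁻ _, ENNReal.ofReal η ∂(Measure.infinitePi fun _ : ℕ =>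
      M.P.prod (volume : Measure unitInterval)) ≤ _)
  rw [Measure.prod_apply (hm hSω |>.preimage (measurable_prodMk_left (x := s)))]
  refine (lintegral_mono fun x => ?_).trans (by simp : ∫⁻ _, ENNReal.ofReal η ∂M.P ≤ _)
  refine le_trans (le_of_eq ?_) ((volume_separates_le
    (demand f θ α x (𝒜.played f θ α t (ω, s) x))
    (demand f θ' α' x (𝒜.played f θ α t (ω, s) x))).trans
      (ENNReal.ofReal_le_ofReal (hη _ _)))
  congr 1
  ext v
  simp only [mem_preimage, disagreement, mem_ofPred_eq, played, Function.update_self,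
    history_update 𝒜 f θ α ω s t _ le_rfl]

/-- If two instances have demands within `η` of each other, then an algorithm that is fair under
either of them is fair under both at once with the corresponding probability. -/
theorem exists_fair_under_both (hf : Measurable f) (ν : Measure Ω) [IsProbabilityMeasure ν]
    {η δ q : ℝ} (hη₀ : 0 ≤ η) (hη : ∀ (x : M.𝒳) (p : Icc M.pLow M.pHigh),
      |demand f θ α x p - demand f θ' α' x p| ≤ η) (T : ℕ)
    (h : 𝒜.FairWithProb f ν T δ q θ α) (h' : 𝒜.FairWithProb f ν T δ q θ' α') :
    ∃ E : Set (M.Sample Ω), MeasurableSet E ∧ 2 * q - 1 - T * η ≤ (M.sampleLaw ν).real E ∧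
      ∀ z ∈ E, ∀ t < T, 𝒜.played f θ α t z ∈ M.fairPolicies θ δ ∩ M.fairPolicies θ' δ := by
  obtain ⟨E, hE, hEs, hEq⟩ := h
  obtain ⟨E', hE', hEs', hEq'⟩ := h'
  set S : Set (M.Sample Ω) := ⋃ t ∈ Finset.range T, 𝒜.disagreement f θ θ' α α' t with hS
  have hSm : MeasurableSet S := Finset.measurableSet_biUnion _ fun t _ =>
    𝒜.measurableSet_disagreement f θ θ' α α' hf t
  have hSle : (M.sampleLaw ν).real S ≤ T * η := by
    refine (measureReal_biUnion_finset_le _ _).trans ?_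
    refine (Finset.sum_le_card_nsmul _ _ η fun t _ => ?_).trans (by simp)
    exact ENNReal.toReal_le_of_le_ofReal hη₀
      (𝒜.sampleLaw_disagreement_le f θ θ' α α' hf ν hη t)
  refine ⟨(E ∩ E') \ S, (hE.inter hE').diff hSm, ?_, ?_⟩
  -- Inclusion-exclusion gives `E ∩ E'` probability at least `2q - 1`; the union bound on `S` costs
  -- a further `T * η`.
  · have h1 := measureReal_union_add_inter (μ := M.sampleLaw ν) (s := E) hE'
    have h2 : (M.sampleLaw ν).real (E ∪ E') ≤ 1 := measureReal_le_one
    have h3 : (M.sampleLaw ν).real (E ∩ E') ≤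
        (M.sampleLaw ν).real ((E ∩ E') \ S) + (M.sampleLaw ν).real S :=
      (measureReal_mono (by intro z hz; by_cases z ∈ S <;> simp_all)).trans
        (measureReal_union_le ((E ∩ E') \ S) S)
    linarith
  · rintro z ⟨⟨hz, hz'⟩, hzS⟩ t ht
    have heq : 𝒜.history f θ α z t = 𝒜.history f θ' α' z t := by
      refine 𝒜.history_eq_of_notMem_disagreement f θ θ' α α' (T := T) (fun s hs hmem => hzS ?_) ht.le
      exact mem_biUnion (Finset.mem_coe.2 (Finset.mem_range.2 hs)) hmem
    refine ⟨hEs hz t ht, ?_⟩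
    have := hEs' hz' t ht
    rwa [played, ← heq] at this

/-- If no policy has negative regret, and every policy that is fair under two instances with
demands within `η` of each other has regret at least `κ` under the first one, then the expected
regret is linear in the horizon. -/
theorem le_expectedRegret (hf : Measurable f) (ν : Measure Ω) [IsProbabilityMeasure ν]
    {η δ q κ K : ℝ} (hη₀ : 0 ≤ η) (hη : ∀ (x : M.𝒳) (p : Icc M.pLow M.pHigh),
      |demand f θ α x p - demand f θ' α' x p| ≤ η) (T : ℕ)
    (h : 𝒜.FairWithProb f ν T δ q θ α) (h' : 𝒜.FairWithProb f ν T δ q θ' α')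
    (hopt : ∀ π : M.Policy, M.revenue f θ α π ≤ M.optRevenue f δ θ α)
    (hbdd : ∀ π : M.Policy, K ≤ M.revenue f θ α π) (hκ₀ : 0 ≤ κ)
    (hκ : ∀ π ∈ M.fairPolicies θ δ ∩ M.fairPolicies θ' δ,
      κ ≤ M.optRevenue f δ θ α - M.revenue f θ α π) :
    (2 * q - 1 - T * η) * (T * κ) ≤ 𝒜.expectedRegret f ν T δ θ α := by
  obtain ⟨E, hE, hEq, hEf⟩ := 𝒜.exists_fair_under_both f θ θ' α α' hf ν hη₀ hη T h h'
  have hint : Integrable (fun z => ∑ t ∈ Finset.range T,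
      (M.optRevenue f δ θ α - M.revenue f θ α (𝒜.played f θ α t z))) (M.sampleLaw ν) := by
    refine integrable_finsetSum _ fun t _ => ?_
    refine Integrable.of_bound (C := M.optRevenue f δ θ α - K) ?_ (.of_forall fun z => ?_)
    · exact (measurable_const.sub (𝒜.measurable_revenue_played f θ α hf t)).aestronglyMeasurable
    · rw [Real.norm_of_nonneg (sub_nonneg.2 (hopt _))]
      linarith [hbdd (𝒜.played f θ α t z)]
  -- On `E` each of the `T` periods costs at least `κ`; off `E` the regret is still nonnegative, by
  -- `hopt`.
  have hind : ∫ z, E.indicator (fun _ => T * κ) z ∂(M.sampleLaw ν) ≤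
      𝒜.expectedRegret f ν T δ θ α := by
    refine integral_mono ((integrable_const _).indicator hE) hint fun z => ?_
    by_cases hz : z ∈ E
    · rw [indicator_of_mem hz]
      have := Finset.card_nsmul_le_sum (Finset.range T)
        (fun t => M.optRevenue f δ θ α - M.revenue f θ α (𝒜.played f θ α t z)) κ
        fun t ht => hκ _ (hEf z hz t (Finset.mem_range.1 ht))
      simpa using this
    · rw [indicator_of_notMem hz]
      exact Finset.sum_nonneg fun t _ => sub_nonneg.2 (hopt _)
  rw [integral_indicator hE, setIntegral_const, smul_eq_mul] at hind
  exact (mul_le_mul_of_nonneg_right hEq (by positivity)).trans hind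

end Algorithm

/-! ### Rigidity under two directions -/

/-- A function on a square that is Lipschitz in each of two linear functionals with distinct
directions is constant. -/
theorem eq_of_lipschitz_two_directions {F : ℝ → ℝ → ℝ} {l u δ ε : ℝ} (hlu : l < u)
    (hδ : 0 ≤ δ) (hε : 0 < ε) (hε' : ε < 1)
    (h₀ : ∀ a ∈ Icc l u, ∀ b ∈ Icc l u, ∀ a' ∈ Icc l u, ∀ b' ∈ Icc l u,
      |F a b - F a' b'| ≤ δ * |(a - a') + (b - b')|)
    (h₁ : ∀ a ∈ Icc l u, ∀ b ∈ Icc l u, ∀ a' ∈ Icc l u, ∀ b' ∈ Icc l u,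
      |F a b - F a' b'| ≤ δ * |(a - a') + (1 - ε) * (b - b')|) :
    ∀ a ∈ Icc l u, ∀ b ∈ Icc l u, F a b = F l l := by
  set h : ℝ → ℝ := fun s => F s s
  have eq₀ : ∀ a ∈ Icc l u, ∀ b ∈ Icc l u, ∀ a' ∈ Icc l u, ∀ b' ∈ Icc l u,
      (a - a') + (b - b') = 0 → F a b = F a' b' := fun a ha b hb a' ha' b' hb' h0 => by
    have := h₀ a ha b hb a' ha' b' hb'
    rw [h0, abs_zero, mul_zero] at this
    exact sub_eq_zero.1 (abs_nonpos_iff.1 this)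
  have eq₁ : ∀ a ∈ Icc l u, ∀ b ∈ Icc l u, ∀ a' ∈ Icc l u, ∀ b' ∈ Icc l u,
      (a - a') + (1 - ε) * (b - b') = 0 → F a b = F a' b' := fun a ha b hb a' ha' b' hb' h0 => by
    have := h₁ a ha b hb a' ha' b' hb'
    rw [h0, abs_zero, mul_zero] at this
    exact sub_eq_zero.1 (abs_nonpos_iff.1 this)
  have hloc : ∀ s ∈ Ioo l u, h =ᶠ[nhds s] fun _ => h s := by
    intro s hs
    have hr : 0 < ε / 2 * min (s - l) (u - s) :=
      mul_pos (half_pos hε) (lt_min (sub_pos.2 hs.1) (sub_pos.2 hs.2))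
    filter_upwards [Metric.ball_mem_nhds s hr, Ioo_mem_nhds hs.1 hs.2] with s' hs' hs''
    rw [Metric.mem_ball, Real.dist_eq] at hs'
    -- The point `(s + t, s - t)` lies on the level line of the first functional through `(s, s)`;
    -- this `t` also puts it on the level line of the second through `(s', s')`. The radius chosen
    -- for `s'` keeps the point in the square.
    obtain ⟨t, ht⟩ : ∃ t, t * ε = (s' - s) * (2 - ε) :=
      ⟨(s' - s) * (2 - ε) / ε, div_mul_cancel₀ _ hε.ne'⟩
    have htle : |t| ≤ min (s - l) (u - s) := by
      have h2 : |t| * ε = |s' - s| * (2 - ε) := by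
        have := congrArg abs ht
        rwa [abs_mul, abs_mul, abs_of_pos hε, abs_of_pos (by linarith : 0 < 2 - ε)] at this
      have h3 : |s' - s| * (2 - ε) ≤ |s' - s| * 2 :=
        mul_le_mul_of_nonneg_left (by linarith) (abs_nonneg _)
      have h4 : |t| * ε ≤ min (s - l) (u - s) * ε := by linarith
      exact le_of_mul_le_mul_right h4 hε
    have h1 := abs_le.1 (htle.trans (min_le_left _ _))
    have h2 := abs_le.1 (htle.trans (min_le_right _ _))
    have hp : s + t ∈ Icc l u := ⟨by linarith, by linarith⟩
    have hm : s - t ∈ Icc l u := ⟨by linarith, by linarith⟩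
    have hsI := Ioo_subset_Icc_self hs
    have hsI' := Ioo_subset_Icc_self hs''
    have e1 := eq₀ _ hp _ hm s hsI s hsI (by ring)
    have e2 := eq₁ _ hp _ hm s' hsI' s' hsI' (by linarith)
    exact e2.symm.trans e1
  have hcont : ContinuousOn h (Icc l u) := by
    have : LipschitzOnWith (Real.toNNReal (2 * δ)) h (Icc l u) := by
      refine LipschitzOnWith.of_dist_le_mul fun x hx y hy => ?_
      rw [Real.dist_eq, Real.dist_eq, Real.coe_toNNReal _ (by positivity)]
      refine (h₀ x hx x hx y hy y hy).trans (le_of_eq ?_)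
      rw [← two_mul, abs_mul, abs_two]
      ring
    exact this.continuousOn
  -- Local constancy gives constancy on the open interval; continuity extends it to the endpoints,
  -- where the zigzag has no room.
  have hderiv : ∀ s ∈ Ioo l u, HasDerivAt h 0 s := fun s hs =>
    (hasDerivAt_const s (h s)).congr_of_eventuallyEq (hloc s hs)
  obtain ⟨k, hk⟩ := isOpen_Ioo.exists_is_const_of_deriv_eq_zero isPreconnected_Ioo
    (fun s hs => (hderiv s hs).differentiableAt.differentiableWithinAt)
    (fun s hs => (hderiv s hs).deriv)
  have hconst : EqOn h (fun _ => k) (Icc l u) :=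
    EqOn.of_subset_closure (s := Ioo l u) hk hcont continuousOn_const Ioo_subset_Icc_self
      (by rw [closure_Ioo hlu.ne])
  have hl : l ∈ Icc l u := left_mem_Icc.2 hlu.le
  intro a ha b hb
  have hmid : (a + b) / 2 ∈ Icc l u := ⟨by linarith [ha.1, hb.1], by linarith [ha.2, hb.2]⟩
  rw [eq₀ a ha b hb _ hmid _ hmid (by ring)]
  exact (hconst hmid).trans (hconst hl).symm

/-! ### Integration on the unit square -/

instance isOpenPosMeasure_unitInterval : (volume : Measure unitInterval).IsOpenPosMeasure := by
  refine ⟨fun s hs ⟨x, hx⟩ h0 => ?_⟩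
  obtain ⟨U, hU, rfl⟩ := isOpen_induced_iff.1 hs
  have hx' : (x : ℝ) ∈ closure (Ioo (0 : ℝ) 1) := by
    rw [closure_Ioo zero_ne_one]; exact x.2
  obtain ⟨y, hyU, hy⟩ := mem_closure_iff.1 hx' U hU hx
  have hpos := (hU.inter isOpen_Ioo).measure_pos (volume : Measure ℝ) ⟨y, hyU, hy⟩
  rw [unitInterval.volume_apply] at h0
  refine hpos.ne' (measure_mono_null ?_ h0)
  rintro y ⟨hyU, hy⟩
  exact ⟨⟨y, Ioo_subset_Icc_self hy⟩, hyU, rfl⟩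

theorem integral_unitInterval_pow (n : ℕ) :
    ∫ w : unitInterval, (w : ℝ) ^ n = 1 / (n + 1) := by
  rw [unitInterval.measurePreserving_coe.integral_comp unitInterval.measurableEmbedding_coe
    (fun r : ℝ => r ^ n)]
  change ∫ r in Icc (0 : ℝ) 1, r ^ n = _
  rw [integral_Icc_eq_integral_Ioc, ← intervalIntegral.integral_of_le zero_le_one, integral_pow]
  simp

/-- The integral of a quadratic polynomial over the unit square. -/
theorem integral_unitSquare_quadratic (a b c e g k : ℝ) :
    ∫ w : unitInterval × unitInterval, (a + b * w.1 + c * w.2 + e * (w.1 : ℝ) ^ 2 +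
      g * (w.2 : ℝ) ^ 2 + k * (w.1 * w.2)) = a + b / 2 + c / 2 + e / 3 + g / 3 + k / 4 := by
  have hi : ∀ φ : unitInterval × unitInterval → ℝ, Continuous φ → Integrable φ := fun φ hφ =>
    hφ.integrable_of_hasCompactSupport (HasCompactSupport.of_compactSpace φ)
  have h1 : ∀ (φ : unitInterval → ℝ),
      ∫ w : unitInterval × unitInterval, φ w.1 = ∫ v, φ v := fun φ => by
    have := integral_prod_mul (μ := (volume : Measure unitInterval))
      (ν := (volume : Measure unitInterval)) φ (fun _ => (1 : ℝ))
    simpa [Measure.volume_eq_prod] using this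
  have h2 : ∀ (φ : unitInterval → ℝ),
      ∫ w : unitInterval × unitInterval, φ w.2 = ∫ v, φ v := fun φ => by
    have := integral_prod_mul (μ := (volume : Measure unitInterval))
      (ν := (volume : Measure unitInterval)) (fun _ => (1 : ℝ)) φ
    simpa [Measure.volume_eq_prod] using this
  have p1 : ∫ v : unitInterval, (v : ℝ) = 1 / 2 := by
    have := integral_unitInterval_pow 1
    norm_num at this ⊢
    exact this
  have p2 : ∫ v : unitInterval, (v : ℝ) ^ 2 = 1 / 3 := by
    have := integral_unitInterval_pow 2
    norm_num at this ⊢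
    exact this
  have p3 : ∫ w : unitInterval × unitInterval, (w.1 : ℝ) * w.2 = 1 / 4 := by
    have := integral_prod_mul (μ := (volume : Measure unitInterval))
      (ν := (volume : Measure unitInterval)) (fun v => (v : ℝ)) (fun v => (v : ℝ))
    rw [p1] at this
    exact this.trans (by norm_num)
  rw [integral_add (hi _ (by fun_prop)) (hi _ (by fun_prop)),
    integral_add (hi _ (by fun_prop)) (hi _ (by fun_prop)),
    integral_add (hi _ (by fun_prop)) (hi _ (by fun_prop)),
    integral_add (hi _ (by fun_prop)) (hi _ (by fun_prop)),
    integral_add (hi _ (by fun_prop)) (hi _ (by fun_prop)),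
    integral_const_mul, integral_const_mul, integral_const_mul, integral_const_mul,
    integral_const_mul, h1 (fun v => (v : ℝ)), h2 (fun v => (v : ℝ)),
    h1 (fun v => (v : ℝ) ^ 2), h2 (fun v => (v : ℝ) ^ 2), p1, p2, p3]
  simp
  ring

/-! ### The square model and its standing assumptions -/

/-- The square `[9/10, 1]²` of contexts. -/
def contextSquare : Set (EuclideanSpace ℝ (Fin 2)) := {x | ∀ i, x i ∈ Icc (9 / 10 : ℝ) 1}

/-- The affine parametrization of the square of contexts by the unit square. -/
def contextOfUnit (w : unitInterval × unitInterval) : contextSquare :=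
  ⟨!₂[(9 + (w.1 : ℝ)) / 10, (9 + (w.2 : ℝ)) / 10], by
    have h1 := w.1.2
    have h2 := w.2.2
    intro i
    fin_cases i <;> simp <;> constructor <;> linarith [h1.1, h1.2, h2.1, h2.2]⟩

theorem continuous_contextOfUnit : Continuous contextOfUnit := by
  refine Continuous.subtype_mk ((PiLp.continuous_toLp 2 _).comp (continuous_pi fun i => ?_)) _
  fin_cases i <;> simp <;> fun_prop

theorem surjective_contextOfUnit : Function.Surjective contextOfUnit := by
  rintro ⟨x, hx⟩
  have h0 := hx 0
  have h1 := hx 1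
  refine ⟨(⟨10 * x 0 - 9, by linarith [h0.1], by linarith [h0.2]⟩,
    ⟨10 * x 1 - 9, by linarith [h1.1], by linarith [h1.2]⟩), Subtype.ext ?_⟩
  ext i
  fin_cases i <;> simp [contextOfUnit]

theorem utility_eq (x θ : EuclideanSpace ℝ (Fin 2)) : utility x θ = x 0 * θ 0 + x 1 * θ 1 := by
  simp [utility, PiLp.inner_apply, Fin.sum_univ_two, mul_comm]

/-- Uniform contexts on the square `[9/10, 1]²`, with parameters in the square `[9/20, 1/2]²` and
price sensitivities in `[1/(2δ), 5/(8δ)]`. -/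
def squareModel (δ : ℝ) (hδ : 0 < δ) (hδ' : δ ≤ 1 / 2) : PricingModel 2 where
  𝒳 := contextSquare
  measurableSet_𝒳 := by
    have : contextSquare = ⋂ i : Fin 2, (fun x : EuclideanSpace ℝ (Fin 2) => x i) ⁻¹'
        Icc (9 / 10 : ℝ) 1 := by ext x; simp [contextSquare]
    rw [this]
    exact MeasurableSet.iInter fun i => measurableSet_Icc.preimage (by fun_prop)
  P := Measure.map contextOfUnit volume
  isProb := Measure.isProbabilityMeasure_map continuous_contextOfUnit.measurable.aemeasurable
  fullSupport := continuous_contextOfUnit.isOpenPosMeasure_map surjective_contextOfUnit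
  pLow := 0
  -- Optimal prices `u / (2α)` are at most `δ`, so they stay strictly inside; prices this low keep
  -- `αp ≤ 3/4 ≤ u`, so demands are nonnegative.
  pHigh := 6 * δ / 5
  pLow_nonneg := le_rfl
  pLow_lt_pHigh := by positivity
  pHigh_le_one := by linarith
  Θ := {θ | ∀ i, θ i ∈ Icc (9 / 20 : ℝ) (1 / 2)}
  -- The lower end makes `u / (2α)` `δ`-Lipschitz in `u`; the upper end is what `αp ≤ 3/4` needs.
  A := Icc (1 / (2 * δ)) (5 / (8 * δ))
  A_nonneg := fun α hα => (by positivity : 0 ≤ 1 / (2 * δ)).trans hα.1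

section SquareModel

variable {δ : ℝ} (hδ : 0 < δ) (hδ' : δ ≤ 1 / 2)

theorem integral_squareModel {g : contextSquare → ℝ} (hg : Continuous g) :
    ∫ x, g x ∂(squareModel δ hδ hδ').P = ∫ w, g (contextOfUnit w) :=
  integral_map continuous_contextOfUnit.measurable.aemeasurable hg.aestronglyMeasurable


theorem utility_mem_Icc {x θ : EuclideanSpace ℝ (Fin 2)} (hx : x ∈ contextSquare)
    (hθ : ∀ i, θ i ∈ Icc (9 / 20 : ℝ) (1 / 2)) : utility x θ ∈ Icc (3 / 4 : ℝ) 1 := by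
  rw [utility_eq]
  have h : ∀ i, 81 / 200 ≤ x i * θ i ∧ x i * θ i ≤ 1 / 2 := fun i => by
    obtain ⟨h1, h2⟩ := hx i
    obtain ⟨h3, h4⟩ := hθ i
    constructor <;> nlinarith
  constructor <;> linarith [(h 0).1, (h 0).2, (h 1).1, (h 1).2]

theorem mem_sensitivities_iff {δ : ℝ} (hδ : 0 < δ) {α : ℝ} :
    α ∈ Icc (1 / (2 * δ)) (5 / (8 * δ)) ↔ 1 ≤ 2 * (α * δ) ∧ 8 * (α * δ) ≤ 5 := by
  rw [mem_Icc, div_le_iff₀ (by positivity), le_div_iff₀ (by positivity)]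
  constructor <;> rintro ⟨h1, h2⟩ <;> constructor <;> linarith

theorem boundedness_squareModel :
    (squareModel δ hδ hδ').Boundedness (fun u => u) 1 1 (3 / 4) 1 := by
  refine ⟨by norm_num, le_rfl, by norm_num, by norm_num, le_rfl, ?_⟩
  intro x hx p hp θ hθ α hα
  have hu := utility_mem_Icc hx hθ
  obtain ⟨ha1, ha2⟩ := (mem_sensitivities_iff hδ).1 hα
  have hα0 : 0 ≤ α := (squareModel δ hδ hδ').A_nonneg α hα
  obtain ⟨hp0, hp1⟩ : 0 ≤ p ∧ p ≤ 6 * δ / 5 := hp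
  have h1 : α * p ≤ 3 / 4 := by
    have := mul_le_mul_of_nonneg_left hp1 hα0
    linarith
  have h2 : 0 ≤ α * p := by positivity
  have hd : utility x θ - α * p ∈ Icc (0 : ℝ) 1 := ⟨by linarith [hu.1], by linarith [hu.2]⟩
  exact ⟨hu, ⟨by linarith [hd.1], hd.2⟩, hd⟩

/-- Completing the square in the linear-demand revenue. -/
theorem revenueAt_eq {α : ℝ} (hα : 0 < α) (u p : ℝ) :
    revenueAt (fun u => u) α u p = u ^ 2 / (4 * α) - α * (p - u / (2 * α)) ^ 2 := by
  unfold revenueAt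
  field_simp
  ring

theorem pos_of_one_le {δ : ℝ} (hδ : 0 < δ) {α : ℝ} (h : 1 ≤ 2 * (α * δ)) : 0 < α :=
  pos_of_mul_pos_left (by linarith : 0 < α * δ) hδ.le

theorem optimalPrice_mem {δ : ℝ} (hδ : 0 < δ) {α u : ℝ} (hα : 1 ≤ 2 * (α * δ)) (hu : u ∈ Icc (3 / 4 : ℝ) 1) :
    u / (2 * α) ∈ Ioo 0 (6 * δ / 5) := by
  have hα0 := pos_of_one_le hδ hα
  have hu0 : 0 < u := by linarith [hu.1]
  refine ⟨by positivity, ?_⟩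
  rw [div_lt_iff₀ (by positivity)]
  linarith [hu.2]

theorem smoothUnimodal_squareModel :
    (squareModel δ hδ hδ').SmoothUnimodal (fun u => u) 1 (3 / 4) 1 1 2 := by
  refine ⟨by norm_num, contDiff_id, ?_, ?_⟩
  · intro u hu
    have h1 : deriv (fun u : ℝ => u) = fun _ => 1 := by ext; simp
    rw [h1]
    simpa using abs_le.2 hu
  · intro α hα u hu
    obtain ⟨ha, -⟩ := (mem_sensitivities_iff hδ).1 hα
    have hα0 := pos_of_one_le hδ ha
    -- This is where `δ ≤ 1/2` enters: the curvature `α` of the revenue is at least `1 = σ / 2`.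
    have hα1 : 1 ≤ α := by nlinarith
    refine ⟨u / (2 * α), optimalPrice_mem hδ ha hu, ?_, ?_, ?_⟩
    · intro p _ p' hp' hpp'
      rw [revenueAt_eq hα0, revenueAt_eq hα0]
      have : (p' - u / (2 * α)) ^ 2 ≤ (p - u / (2 * α)) ^ 2 := by
        have := hp'.2
        nlinarith
      nlinarith
    · intro p hp p' _ hpp'
      rw [revenueAt_eq hα0, revenueAt_eq hα0]
      have : (p - u / (2 * α)) ^ 2 ≤ (p' - u / (2 * α)) ^ 2 := by
        have := hp.1
        nlinarith
      nlinarith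
    · intro p' _
      rw [revenueAt_eq hα0, revenueAt_eq hα0]
      nlinarith [sq_nonneg (p' - u / (2 * α))]

theorem utility_contextOfUnit (w : unitInterval × unitInterval) (θ : EuclideanSpace ℝ (Fin 2)) :
    utility (contextOfUnit w).1 θ =
      (9 + (w.1 : ℝ)) / 10 * θ 0 + (9 + (w.2 : ℝ)) / 10 * θ 1 := by
  rw [utility_eq]
  simp [contextOfUnit]

/-- For a fixed second coordinate, the utility is affine in the first uniform variable with slope `θ
0 / 10 ≥ 9/200`, so its conditional density is at most `200/9 ≤ 25 = 50 / 2`. -/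
theorem stochasticContexts_squareModel :
    (squareModel δ hδ hδ').StochasticContexts 1 50 := by
  intro θ hθ U hU hUs
  have hθ0 : (9 / 20 : ℝ) ≤ θ 0 := (hθ 0).1
  have hmeas : Measurable fun x : contextSquare => utility x.1 θ :=
    measurable_utility (M := squareModel δ hδ hδ') θ
  have hle : (squareModel δ hδ hδ').P {x | utility x.1 θ ∈ U} ≤
      ENNReal.ofReal 25 * volume U := by
    change (Measure.map contextOfUnit volume) ((fun x : contextSquare => utility x.1 θ) ⁻¹' U) ≤ _
    have hS := (hU.preimage hmeas).preimage continuous_contextOfUnit.measurable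
    rw [Measure.map_apply continuous_contextOfUnit.measurable (hU.preimage hmeas),
      Measure.volume_eq_prod, Measure.prod_apply_symm hS]
    refine (lintegral_mono fun v => ?_).trans (by simp :
      ∫⁻ _ : unitInterval, ENNReal.ofReal 25 * volume U ≤ _)
    rw [unitInterval.volume_apply]
    set c : ℝ := 9 / 10 * θ 0 + (9 + (v : ℝ)) / 10 * θ 1 with hc
    have hsub : Subtype.val '' ((fun x : unitInterval => (x, v)) ⁻¹' (contextOfUnit ⁻¹'
        ((fun x : contextSquare => utility x.1 θ) ⁻¹' U))) ⊆
        (fun r : ℝ => θ 0 / 10 * r) ⁻¹' ((fun r => c + r) ⁻¹' U) := by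
      rintro _ ⟨x, hx, rfl⟩
      simp only [mem_preimage, utility_contextOfUnit] at hx ⊢
      convert hx using 1
      rw [hc]; ring
    refine (measure_mono hsub).trans ?_
    rw [Real.volume_preimage_mul_left (by linarith), measure_preimage_add]
    gcongr
    rw [abs_of_pos (by positivity), inv_div, div_le_iff₀ (by linarith)]
    linarith
  have hfin : volume U ≠ ⊤ := ne_top_of_le_ne_top (by simp) (measure_mono hUs)
  have := ENNReal.toReal_mono (ENNReal.mul_ne_top ENNReal.ofReal_ne_top hfin) hle
  rw [ENNReal.toReal_mul, ENNReal.toReal_ofReal (by norm_num)] at this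
  calc _ ≤ 25 * volume.real U := this
    _ = _ := by ring

theorem continuous_coord (i : Fin 2) : Continuous fun x : contextSquare => x.1 i := by fun_prop

/-- The coordinates are independent and uniform on an interval of length `1/10`, whose variance is
`1/1200`. -/
theorem covMatrix_squareModel :
    (squareModel δ hδ hδ').covMatrix = (1 / 1200 : ℝ) • 1 := by
  have h0 : ∀ w, (contextOfUnit w).1 0 = (9 + (w.1 : ℝ)) / 10 := fun w => by simp [contextOfUnit]
  have h1 : ∀ w, (contextOfUnit w).1 1 = (9 + (w.2 : ℝ)) / 10 := fun w => by simp [contextOfUnit]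
  have e0 : ∫ w, (contextOfUnit w).1 0 = 19 / 20 := by
    simp only [h0]
    convert integral_unitSquare_quadratic (9 / 10) (1 / 10) 0 0 0 0 using 1
    · congr 1; ext w; ring
    · norm_num
  have e1 : ∫ w, (contextOfUnit w).1 1 = 19 / 20 := by
    simp only [h1]
    convert integral_unitSquare_quadratic (9 / 10) 0 (1 / 10) 0 0 0 using 1
    · congr 1; ext w; ring
    · norm_num
  have e00 : ∫ w, (contextOfUnit w).1 0 * (contextOfUnit w).1 0 = 271 / 300 := by
    simp only [h0]
    convert integral_unitSquare_quadratic (81 / 100) (18 / 100) 0 (1 / 100) 0 0 using 1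
    · congr 1; ext w; ring
    · norm_num
  have e11 : ∫ w, (contextOfUnit w).1 1 * (contextOfUnit w).1 1 = 271 / 300 := by
    simp only [h1]
    convert integral_unitSquare_quadratic (81 / 100) 0 (18 / 100) 0 (1 / 100) 0 using 1
    · congr 1; ext w; ring
    · norm_num
  have e01 : ∫ w, (contextOfUnit w).1 0 * (contextOfUnit w).1 1 = 361 / 400 := by
    simp only [h0, h1]
    convert integral_unitSquare_quadratic (81 / 100) (9 / 100) (9 / 100) 0 0 (1 / 100) using 1
    · congr 1; ext w; ring
    · norm_num
  have e10 : ∫ w, (contextOfUnit w).1 1 * (contextOfUnit w).1 0 = 361 / 400 := by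
    simpa only [mul_comm] using e01
  have hE : ∀ i, ∫ x, x.1 i ∂(squareModel δ hδ hδ').P = ∫ w, (contextOfUnit w).1 i := fun i =>
    integral_squareModel hδ hδ' (continuous_coord i)
  have hE2 : ∀ i j, ∫ x, x.1 i * x.1 j ∂(squareModel δ hδ hδ').P =
      ∫ w, (contextOfUnit w).1 i * (contextOfUnit w).1 j := fun i j =>
    integral_squareModel hδ hδ' ((continuous_coord i).mul (continuous_coord j))
  ext i j
  simp only [covMatrix, Matrix.of_apply, hE, hE2]
  fin_cases i <;> fin_cases j <;> simp [e0, e1, e00, e01, e10, e11] <;> norm_num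

theorem covNondegenerate_squareModel :
    (squareModel δ hδ hδ').CovNondegenerate (1 / 1200) := by
  refine ⟨by norm_num, ?_, ?_⟩
  · refine MemLp.of_bound (C := 2) measurable_subtype_coe.aestronglyMeasurable
      (.of_forall fun x => ?_)
    have hx : ∀ i, x.1 i ∈ Icc (9 / 10 : ℝ) 1 := x.2
    rw [EuclideanSpace.norm_eq, Fin.sum_univ_two]
    refine Real.sqrt_le_iff.2 ⟨by norm_num, ?_⟩
    have h : ∀ i, ‖x.1 i‖ ^ 2 ≤ 1 := fun i => by
      rw [Real.norm_of_nonneg (by linarith [(hx i).1])]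
      nlinarith [(hx i).1, (hx i).2]
    linarith [h 0, h 1]
  · rw [covMatrix_squareModel, sub_self]
    exact Matrix.PosSemidef.zero

theorem assumptions_squareModel : (squareModel δ hδ hδ').Assumptions (fun u => u) :=
  ⟨1, 1, 3 / 4, 1, 1, 2, 50, 1 / 1200, boundedness_squareModel hδ hδ',
    smoothUnimodal_squareModel hδ hδ', stochasticContexts_squareModel hδ hδ',
    covNondegenerate_squareModel hδ hδ'⟩

/-! ### Optimal revenue -/

theorem continuous_utility (θ : EuclideanSpace ℝ (Fin 2)) :
    Continuous fun x : contextSquare => utility x.1 θ := by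
  unfold utility; fun_prop

theorem revenue_nonneg {θ : EuclideanSpace ℝ (Fin 2)} {α : ℝ}
    (hθ : θ ∈ (squareModel δ hδ hδ').Θ) (hα : α ∈ (squareModel δ hδ hδ').A)
    (π : (squareModel δ hδ hδ').Policy) :
    0 ≤ (squareModel δ hδ hδ').revenue (fun u => u) θ α π := by
  refine integral_nonneg fun x => ?_
  have := (boundedness_squareModel hδ hδ').2.2.2.2.2 x.1 x.2 (π x) (π x).2 θ hθ α hα
  exact mul_nonneg (π x).2.1 this.2.2.1

/-- Pointwise completion of the square: the bound holds for every policy, fair or not. -/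
theorem revenue_le {θ : EuclideanSpace ℝ (Fin 2)} {α : ℝ}
    (hθ : θ ∈ (squareModel δ hδ hδ').Θ) (hα : α ∈ (squareModel δ hδ hδ').A)
    (π : (squareModel δ hδ hδ').Policy) :
    (squareModel δ hδ hδ').revenue (fun u => u) θ α π ≤
      ∫ x, utility x.1 θ ^ 2 / (4 * α) ∂(squareModel δ hδ hδ').P := by
  have hα0 := pos_of_one_le hδ ((mem_sensitivities_iff hδ).1 hα).1
  refine integral_mono_of_nonneg (.of_forall fun x => ?_) ?_ (.of_forall fun x => ?_)
  · have := (boundedness_squareModel hδ hδ').2.2.2.2.2 x.1 x.2 (π x) (π x).2 θ hθ α hα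
    exact mul_nonneg (π x).2.1 this.2.2.1
  · have hc : Continuous fun x : contextSquare => utility x.1 θ ^ 2 / (4 * α) :=
      ((continuous_utility θ).pow 2).div_const _
    refine Integrable.of_bound (C := 1 / (4 * α)) hc.aestronglyMeasurable
      (.of_forall fun x => ?_)
    have hu := utility_mem_Icc x.2 hθ
    rw [Real.norm_of_nonneg (by positivity)]
    gcongr
    nlinarith [hu.1, hu.2]
  · have h := revenueAt_eq hα0 (utility x.1 θ) (π x)
    have : 0 ≤ α * ((π x : ℝ) - utility x.1 θ / (2 * α)) ^ 2 := by positivity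
    dsimp only
    linarith

/-- The unconstrained optimal policy is fair. -/
theorem exists_optimal_policy {θ : EuclideanSpace ℝ (Fin 2)} {α : ℝ}
    (hθ : θ ∈ (squareModel δ hδ hδ').Θ) (hα : α ∈ (squareModel δ hδ hδ').A) :
    ∃ π ∈ (squareModel δ hδ hδ').fairPolicies θ δ,
      (squareModel δ hδ hδ').revenue (fun u => u) θ α π =
        ∫ x, utility x.1 θ ^ 2 / (4 * α) ∂(squareModel δ hδ hδ').P := by
  have ha := ((mem_sensitivities_iff hδ).1 hα).1
  have hα0 := pos_of_one_le hδ ha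
  refine ⟨fun x => ⟨utility x.1 θ / (2 * α),
    Ioo_subset_Icc_self (optimalPrice_mem hδ ha (utility_mem_Icc x.2 hθ))⟩, ?_, ?_⟩
  · intro x x'
    have hsub : utility (x.1 - x'.1) θ = utility x.1 θ - utility x'.1 θ := inner_sub_left _ _ _
    dsimp only
    rw [hsub, ← sub_div, abs_div, abs_of_pos (by positivity : 0 < 2 * α),
      div_le_iff₀ (by positivity)]
    nlinarith [abs_nonneg (utility x.1 θ - utility x'.1 θ)]
  · refine integral_congr_ae (.of_forall fun x => ?_)
    dsimp only
    rw [revenueAt_eq hα0]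
    simp

theorem hasOptimalFairPolicy_squareModel {θ : EuclideanSpace ℝ (Fin 2)} {α : ℝ}
    (hθ : θ ∈ (squareModel δ hδ hδ').Θ) (hα : α ∈ (squareModel δ hδ hδ').A) :
    (squareModel δ hδ hδ').HasOptimalFairPolicy (fun u => u) δ θ α := by
  obtain ⟨π, hπ, hr⟩ := exists_optimal_policy hδ hδ' hθ hα
  exact ⟨π, hπ, fun π' _ => hr ▸ revenue_le hδ hδ' hθ hα π'⟩

theorem optRevenue_squareModel {θ : EuclideanSpace ℝ (Fin 2)} {α : ℝ}
    (hθ : θ ∈ (squareModel δ hδ hδ').Θ) (hα : α ∈ (squareModel δ hδ hδ').A) :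
    (squareModel δ hδ hδ').optRevenue (fun u => u) δ θ α =
      ∫ x, utility x.1 θ ^ 2 / (4 * α) ∂(squareModel δ hδ hδ').P := by
  obtain ⟨π, hπ, hr⟩ := exists_optimal_policy hδ hδ' hθ hα
  refine IsGreatest.csSup_eq ⟨⟨π, hπ, hr⟩, ?_⟩
  rintro _ ⟨π', -, rfl⟩
  exact revenue_le hδ hδ' hθ hα π'

/-! ### Constant policies and linear regret -/

/-- Policies that are fair under two different directions of the parameter are constant. -/
theorem fairPolicies_inter_const {ε : ℝ} (hε : 0 < ε) (hε' : ε ≤ 1 / 20)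
    {π : (squareModel δ hδ hδ').Policy}
    (hπ : π ∈ (squareModel δ hδ hδ').fairPolicies !₂[1 / 2, 1 / 2] δ ∩
      (squareModel δ hδ hδ').fairPolicies !₂[1 / 2, 1 / 2 - ε] δ) :
    ∃ p : Icc (0 : ℝ) (6 * δ / 5), ∀ x, π x = p := by
  set pt : ℝ → ℝ → contextSquare := fun a b =>
    contextOfUnit (projIcc 0 1 zero_le_one a, projIcc 0 1 zero_le_one b) with hpt
  have hF : ∀ κ : ℝ, π ∈ (squareModel δ hδ hδ').fairPolicies !₂[1 / 2, 1 / 2 - κ] δ →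
      ∀ a ∈ Icc (0 : ℝ) 1, ∀ b ∈ Icc (0 : ℝ) 1, ∀ a' ∈ Icc (0 : ℝ) 1, ∀ b' ∈ Icc (0 : ℝ) 1,
      |(π (pt a b) : ℝ) - π (pt a' b')| ≤
        δ / 20 * |(a - a') + (1 - 2 * κ) * (b - b')| := by
    intro κ h a ha b hb a' ha' b' hb'
    refine (h (pt a b) (pt a' b')).trans (le_of_eq ?_)
    -- In unit-square coordinates, `θ` becomes `(1, 1 - 2κ) / 20`; `κ = 0` and `κ = ε` give the two
    -- directions, at parameter `2 * ε` in the rigidity lemma.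
    have hsub : utility ((pt a b).1 - (pt a' b').1) !₂[1 / 2, 1 / 2 - κ] =
        1 / 20 * ((a - a') + (1 - 2 * κ) * (b - b')) := by
      rw [utility, inner_sub_left]
      change utility _ _ - utility _ _ = _
      rw [utility_contextOfUnit, utility_contextOfUnit]
      simp only [projIcc_of_mem _ ha, projIcc_of_mem _ hb, projIcc_of_mem _ ha',
        projIcc_of_mem _ hb']
      simp
      ring
    rw [hsub, abs_mul, abs_of_pos (by norm_num : (0 : ℝ) < 1 / 20)]
    ring
  have h₀ := hF 0 (by simpa using hπ.1)
  simp only [mul_zero, sub_zero, one_mul] at h₀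
  have key := eq_of_lipschitz_two_directions (F := fun a b => (π (pt a b) : ℝ)) zero_lt_one
    (by positivity : 0 ≤ δ / 20) (by linarith : 0 < 2 * ε) (by linarith) h₀ (hF ε hπ.2)
  refine ⟨π (pt 0 0), fun x => ?_⟩
  obtain ⟨w, rfl⟩ := surjective_contextOfUnit x
  have := key w.1 w.1.2 w.2 w.2.2
  simp only [hpt, projIcc_val] at this
  exact Subtype.ext this

/-- A constant policy loses at least the variance of the optimal price. -/
theorem regret_const_ge {π : (squareModel δ hδ hδ').Policy}
    {p : Icc (0 : ℝ) (6 * δ / 5)} (hπ : ∀ x, π x = p) :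
    δ / 4800 ≤ (∫ x, utility x.1 !₂[1 / 2, 1 / 2] ^ 2 / (4 * (1 / (2 * δ)))
        ∂(squareModel δ hδ hδ').P) -
      (squareModel δ hδ hδ').revenue (fun u => u) !₂[1 / 2, 1 / 2] (1 / (2 * δ)) π := by
  have hu : ∀ w, utility (contextOfUnit w).1 !₂[1 / 2, 1 / 2] =
      9 / 10 + 1 / 20 * w.1 + 1 / 20 * w.2 := fun w => by
    rw [utility_contextOfUnit]; simp; ring
  have h1 : ∫ x, utility x.1 !₂[1 / 2, 1 / 2] ^ 2 / (4 * (1 / (2 * δ)))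
      ∂(squareModel δ hδ hδ').P = δ / 2 * (361 / 400 + 1 / 2400) := by
    refine (integral_squareModel hδ hδ'
      (g := fun x => utility x.1 !₂[1 / 2, 1 / 2] ^ 2 / (4 * (1 / (2 * δ))))
      (((continuous_utility !₂[1 / 2, 1 / 2]).pow 2).div_const _)).trans ?_
    simp only [hu]
    convert integral_unitSquare_quadratic (δ / 2 * (81 / 100)) (δ / 2 * (9 / 100))
      (δ / 2 * (9 / 100)) (δ / 2 * (1 / 400)) (δ / 2 * (1 / 400)) (δ / 2 * (2 / 400)) using 1
    · congr 1; ext w; field_simp; ring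
    · ring
  have h2 : (squareModel δ hδ hδ').revenue (fun u => u) !₂[1 / 2, 1 / 2] (1 / (2 * δ)) π =
      p * (19 / 20) - p ^ 2 / (2 * δ) := by
    unfold revenue revenueAt
    simp only [hπ]
    refine (integral_squareModel hδ hδ'
      (g := fun x => p * (utility x.1 !₂[1 / 2, 1 / 2] - 1 / (2 * δ) * p)) (continuous_const.mul
      ((continuous_utility !₂[1 / 2, 1 / 2]).sub continuous_const))).trans ?_
    simp only [hu]
    convert integral_unitSquare_quadratic (p * (9 / 10) - p ^ 2 / (2 * δ)) (p / 20) (p / 20)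
      0 0 0 using 1
    · congr 1; ext w; field_simp; ring
    · ring
  rw [h1, h2]
  -- With `α = 1 / (2δ)` the optimal price is `δu`, of mean `19δ/20`, and `u` has variance `1/2400`;
  -- the loss is `α` times (variance plus squared bias).
  have : δ / 2 * (361 / 400 + 1 / 2400) - (p * (19 / 20) - (p : ℝ) ^ 2 / (2 * δ)) =
      δ / 4800 + (p - 19 / 20 * δ) ^ 2 / (2 * δ) := by
    field_simp; ring
  rw [this]
  have : 0 ≤ ((p : ℝ) - 19 / 20 * δ) ^ 2 / (2 * δ) := by positivity
  linarith

/-- In the square model, the regret of an algorithm that is fair with high probability is linear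
in the horizon. -/
theorem linear_le_worstCaseRegret {Ω : Type*} [MeasurableSpace Ω] (ν : Measure Ω)
    [IsProbabilityMeasure ν] (T : ℕ) (𝒜 : (squareModel δ hδ hδ').Algorithm Ω)
    (h : ∀ θ ∈ (squareModel δ hδ hδ').Θ, ∀ α ∈ (squareModel δ hδ hδ').A,
      𝒜.FairWithProb (fun u => u) ν T δ 0.95 θ α) :
    ((δ / 6000 * T : ℝ) : EReal) ≤ 𝒜.worstCaseRegret (fun u => u) ν T δ := by
  -- Small enough that `T * ε ≤ 1/20` and that the perturbed parameter stays in `Θ`; the `+ 1`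
  -- covers `T = 0`.
  set ε : ℝ := 1 / (20 * (T + 1)) with hεdef
  have hT : (0 : ℝ) ≤ T := T.cast_nonneg
  have hε : 0 < ε := by positivity
  have hTε : T * ε ≤ 1 / 20 := by
    rw [hεdef, mul_one_div, div_le_iff₀ (by positivity)]; linarith
  have hε' : ε ≤ 1 / 20 := by
    rw [hεdef, div_le_iff₀ (by positivity)]; linarith
  have hα : 1 / (2 * δ) ∈ (squareModel δ hδ hδ').A :=
    (mem_sensitivities_iff hδ).2 (by field_simp; norm_num)
  have hθ : !₂[1 / 2, 1 / 2] ∈ (squareModel δ hδ hδ').Θ := by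
    intro i; fin_cases i <;> simp <;> norm_num
  have hθ' : !₂[1 / 2, 1 / 2 - ε] ∈ (squareModel δ hδ hδ').Θ := by
    refine Fin.forall_fin_two.2 ⟨?_, ?_⟩ <;> simp only [mem_Icc] <;> constructor <;> simp <;>
      linarith
  have hopt := optRevenue_squareModel hδ hδ' hθ hα
  have key := 𝒜.le_expectedRegret (fun u => u) !₂[1 / 2, 1 / 2] !₂[1 / 2, 1 / 2 - ε]
    (1 / (2 * δ)) (1 / (2 * δ)) measurable_id ν (η := ε) (δ := δ) (q := 0.95) (κ := δ / 4800)
    (K := 0) hε.le ?_ T (h _ hθ _ hα) (h _ hθ' _ hα)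
    (fun π => hopt ▸ revenue_le hδ hδ' hθ hα π) (fun π => revenue_nonneg hδ hδ' hθ hα π)
    (by positivity) ?_
  · refine le_trans (EReal.coe_le_coe_iff.2 (le_trans ?_ key)) (le_iSup₂_of_le _ hθ
      (le_iSup₂_of_le _ hα le_rfl))
    -- The probability is at least `0.9 - 0.05`; rounding down to `0.8` gives `0.8 / 4800 = 1 /
    -- 6000`.
    have h1 : (0.8 : ℝ) ≤ 2 * 0.95 - 1 - T * ε := by norm_num; linarith
    refine le_trans (le_of_eq ?_) (mul_le_mul_of_nonneg_right h1 (by positivity))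
    ring
  · intro x p
    have hx : ∀ i, x.1 i ∈ Icc (9 / 10 : ℝ) 1 := x.2
    have : demand (fun u => u) !₂[1 / 2, 1 / 2] (1 / (2 * δ)) x p -
        demand (fun u => u) !₂[1 / 2, 1 / 2 - ε] (1 / (2 * δ)) x p = x.1 1 * ε := by
      unfold demand
      rw [utility_eq, utility_eq]
      simp
      ring
    rw [this, abs_of_nonneg (mul_nonneg (by linarith [(hx 1).1]) hε.le)]
    nlinarith [(hx 1).2]
  · intro π hπ
    obtain ⟨p, hp⟩ := fairPolicies_inter_const hδ hδ' hε hε' hπ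
    rw [hopt]
    exact regret_const_ge hδ hδ' hp

end SquareModel

end PricingModel

end

/-! ### From linear regret to the exponent two thirds -/

theorem rpow_two_thirds_le_natCast (T : ℕ) : (T : ℝ) ^ (2 / 3 : ℝ) ≤ T := by
  rcases T.eq_zero_or_pos with rfl | hT
  · simp
  · calc (T : ℝ) ^ (2 / 3 : ℝ) ≤ (T : ℝ) ^ (1 : ℝ) :=
        Real.rpow_le_rpow_of_exponent_le (by exact_mod_cast hT) (by norm_num)
      _ = T := Real.rpow_one _

/-- Once `T ≥ κ⁻³`, the factor `κ T ^ (1/3)` separating the two sides is at least `1`. -/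
theorem rpow_two_thirds_le_mul {κ : ℝ} (hκ : 0 < κ) {T : ℕ} (hT : ⌈κ⁻¹ ^ 3⌉₊ ≤ T) :
    (T : ℝ) ^ (2 / 3 : ℝ) ≤ κ * T := by
  have h1 : κ⁻¹ ^ 3 ≤ T := (Nat.le_ceil _).trans (by exact_mod_cast hT)
  have hT0 : (0 : ℝ) < T := (by positivity : 0 < κ⁻¹ ^ 3).trans_le h1
  have h2 : κ⁻¹ ≤ (T : ℝ) ^ (1 / 3 : ℝ) := by
    have := Real.rpow_le_rpow (by positivity) h1 (by norm_num : (0 : ℝ) ≤ 1 / 3)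
    rwa [← Real.rpow_natCast, ← Real.rpow_mul (by positivity), Nat.cast_ofNat,
      mul_one_div_cancel (by norm_num), Real.rpow_one] at this
  have h3 : 1 ≤ κ * (T : ℝ) ^ (1 / 3 : ℝ) := by
    rwa [inv_le_iff_one_le_mul₀' hκ] at h2
  calc (T : ℝ) ^ (2 / 3 : ℝ) ≤ (κ * (T : ℝ) ^ (1 / 3 : ℝ)) * (T : ℝ) ^ (2 / 3 : ℝ) :=
        le_mul_of_one_le_left (by positivity) h3
    _ = κ * T := by
        rw [mul_assoc, ← Real.rpow_add hT0]; norm_num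

theorem mainTheorem2 :
    ∃ c : ℝ, 0 < c ∧ ∀ δ₀ : ℝ, 0 < δ₀ → δ₀ ≤ 1 / 2 →
      ∃ (C : ℝ) (T₀ : ℕ) (d : ℕ) (M : PricingModel d), 0 < C ∧
        M.Assumptions (fun u => u) ∧
        (∀ θ ∈ M.Θ, ∀ α ∈ M.A, M.HasOptimalFairPolicy (fun u => u) δ₀ θ α) ∧
        ∀ (T : ℕ) (Ω : Type*) (_ : MeasurableSpace Ω) (ν : Measure Ω), IsProbabilityMeasure ν →
          ∀ 𝒜 : M.Algorithm Ω,
            (∀ θ ∈ M.Θ, ∀ α ∈ M.A, 𝒜.FairWithProb (fun u => u) ν T δ₀ 0.95 θ α) →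
              ((C * (T : ℝ) ^ (2 / 3 : ℝ) : ℝ) : EReal) ≤
                  𝒜.worstCaseRegret (fun u => u) ν T δ₀ ∧
              (T₀ ≤ T →
                ((c * δ₀ ^ (2 / 3 : ℝ) * (T : ℝ) ^ (2 / 3 : ℝ) : ℝ) : EReal) ≤
                  𝒜.worstCaseRegret (fun u => u) ν T δ₀) := by
  -- Since `T₀` may depend on `δ`, it absorbs the small slope `δ / 6000`, and the universal constant
  -- can be `1`.
  refine ⟨1, one_pos, fun δ hδ hδ' => ⟨δ / 6000, ⌈(δ / 6000)⁻¹ ^ 3⌉₊, 2,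
    PricingModel.squareModel δ hδ hδ', by positivity,
    PricingModel.assumptions_squareModel hδ hδ',
    fun θ hθ α hα => PricingModel.hasOptimalFairPolicy_squareModel hδ hδ' hθ hα, ?_⟩⟩
  intro T Ω _ ν hν 𝒜 h𝒜
  have key := PricingModel.linear_le_worstCaseRegret hδ hδ' ν T 𝒜 h𝒜
  refine ⟨le_trans (EReal.coe_le_coe_iff.2 ?_) key,
    fun hT => le_trans (EReal.coe_le_coe_iff.2 ?_) key⟩
  · exact mul_le_mul_of_nonneg_left (rpow_two_thirds_le_natCast T) (by positivity)
  · have h1 : δ ^ (2 / 3 : ℝ) ≤ 1 := Real.rpow_le_one hδ.le (by linarith) (by norm_num)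
    calc 1 * δ ^ (2 / 3 : ℝ) * (T : ℝ) ^ (2 / 3 : ℝ) ≤ (T : ℝ) ^ (2 / 3 : ℝ) := by
          rw [one_mul]
          exact mul_le_of_le_one_left (by positivity) h1
      _ ≤ δ / 6000 * T := rpow_two_thirds_le_mul (by positivity) hT
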